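/- Let $\{a,b\}^+$ be the free semigroup of nonempty finite words over $\{a,b\}$, let $\mu$ be its endomorphism given by $\mu(a)=ab$, $\mu(b)=ba$, and let $\mathbf{t}$ be the Prouhet–Thue–Morse sequence, that is, the infinite word whose prefix of length $2^n$ is $\mu^n(a)$ for every $n\ge 0$. A finite word is a segment of $\mathbf{t}$ if it is a nonempty block of consecutive letters of $\mathbf{t}$. A word $w\in\{a,b\}^+$ is unavoidable in $\mathbf{t}$ (a binary pattern of $\mathbf{t}$) if there is an endomorphism $\varphi$ of $\{a,b\}^+$ such that $\varphi(w)$ is a segment of $\mathbf{t}$. Theorem. A word $w\in\{a,b\}^+$ is unavoidable in $\mathbf{t}$ if and only if it is a segment of $\mathbf{t}$ or one of the two words $a^2ba^2$ and $b^2ab^2$. Moreover, neither of these two words is a segment of $\mathbf{t}$, so that, apart from these two exceptions, the binary patterns of $\mathbf{t}$ are exactly its finite segments. -/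

import Mathlib

namespace ThueMorse

/-- The two-letter alphabet `{a, b}`. -/
inductive Letter where
  | a : Letter
  | b : Letter
  deriving DecidableEq

open Letter

/-- The free semigroup `{a, b}⁺` of nonempty finite words over `{a, b}`. -/
abbrev Word := FreeSemigroup Letter

/-- The one-letter word `a`. -/
abbrev wa : Word := FreeSemigroup.of a

/-- The one-letter word `b`. -/
abbrev wb : Word := FreeSemigroup.of b

/-- The list of letters of a nonempty word, from left to right. -/
def letters {A : Type*} (u : FreeSemigroup A) : List A := u.head :: u.tail

theorem letters_length {A : Type*} (u : FreeSemigroup A) :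
    (letters u).length = u.length := rfl

theorem letters_mul {A : Type*} (u v : FreeSemigroup A) :
    letters (u * v) = letters u ++ letters v := rfl

/-- The endomorphism `μ` of `{a, b}⁺` with `μ(a) = ab` and `μ(b) = ba`. -/
def mu : Word →ₙ* Word :=
  FreeSemigroup.lift fun x => match x with
    | a => wa * wb
    | b => wb * wa

theorem length_mu (u : Word) : (mu u).length = 2 * u.length := by
  induction u using FreeSemigroup.recOnMul with
  | ih1 x => cases x <;> rfl
  | ih2 x y hx hy => rw [map_mul, FreeSemigroup.length_mul, FreeSemigroup.length_mul, hx, hy]; ring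

theorem length_iterate_mu (n : ℕ) (u : Word) : (mu^[n] u).length = 2 ^ n * u.length := by
  induction n with
  | zero => simp
  | succ n ih => rw [Function.iterate_succ_apply', length_mu, ih]; ring

theorem lt_length_iterate_mu (n : ℕ) : n < (letters (mu^[n] wa)).length := by
  rw [letters_length, length_iterate_mu]
  simpa using Nat.lt_two_pow_self

/-- The Prouhet–Thue–Morse sequence `t`, indexed from `0`: its letter at position `n` is that of
`μⁿ(a)`, whose length is `2ⁿ > n`. By `prefix_thueMorse` below, it is the infinite word
whose prefix of length `2ⁿ` is `μⁿ(a)` for every `n`. -/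
def thueMorse (n : ℕ) : Letter := (letters (mu^[n] wa))[n]'(lt_length_iterate_mu n)

theorem iterate_mu_succ_eq (n : ℕ) : mu^[n + 1] wa = mu^[n] wa * mu^[n] wb := by
  induction n with
  | zero => rfl
  | succ n ih =>
    rw [Function.iterate_succ_apply', ih, map_mul, ← ih]
    simp only [Function.iterate_succ_apply']

theorem iterate_mu_prefix {m n : ℕ} (h : m ≤ n) :
    letters (mu^[m] wa) <+: letters (mu^[n] wa) := by
  induction n, h using Nat.le_induction with
  | base => exact List.prefix_refl _
  | succ n _ ih =>
    refine ih.trans ?_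
    rw [iterate_mu_succ_eq, letters_mul]
    exact List.prefix_append _ _

/-- `μⁿ(a)` is the prefix of length `2ⁿ` of `t`. -/
theorem prefix_thueMorse (n : ℕ) :
    letters (mu^[n] wa) = (List.range (2 ^ n)).map thueMorse := by
  have hl : (letters (mu^[n] wa)).length = 2 ^ n := by
    rw [letters_length, length_iterate_mu]; simp
  refine List.ext_getElem (by simp [hl]) fun i h₁ h₂ => ?_
  rw [List.getElem_map, List.getElem_range, thueMorse]
  rcases le_total i n with h | h
  · exact ((iterate_mu_prefix h).getElem (lt_length_iterate_mu i)).symm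
  · exact (iterate_mu_prefix h).getElem h₁

/-- The finite word `u` is a segment of the infinite word `x`: it is a block of consecutive
letters of `x`, starting at some position `m`. -/
def IsSegment {A : Type*} (x : ℕ → A) (u : FreeSemigroup A) : Prop :=
  ∃ m : ℕ, letters u = (List.range u.length).map fun i => x (m + i)

/-- The word `w ∈ A⁺` is avoided by the infinite word `x` over `B`: there is no homomorphism
`φ : A⁺ → B⁺` such that `φ(w)` is a segment of `x`. -/
def IsAvoidedBy {A B : Type*} (w : FreeSemigroup A) (x : ℕ → B) : Prop :=
  ¬ ∃ φ : FreeSemigroup A →ₙ* FreeSemigroup B, IsSegment x (φ w)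

/-- The word `w` is unavoidable in `x`, or a pattern of `x`: it is not avoided by `x`. -/
def IsUnavoidableIn {A B : Type*} (w : FreeSemigroup A) (x : ℕ → B) : Prop :=
  ¬ IsAvoidedBy w x

end ThueMorse

/-!
In the Thue–Morse word `t` the centre of every square is an even position, and a square of odd root
has a root `x` or `x x̄ x`, where `x̄` is the letter other than `x`. Hence `t` is overlap-free, and a
nonerasing image of `w` in `t` is subject to a parity condition for each square in `w`. If `w`
contains a square and all letters have images of even length, then the image is aligned with the
blocks `μ(x)` and `μ` can be cancelled. So it suffices to study images in which some letter has odd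
length.

The parity conditions leave no such image for `ccdccd`, `dccdcc` and `ccddccdd`. A word
that avoids these patterns and overlaps is a segment of `t`, or `ccdcc`, or contains a
configuration of squares which forces an image with a letter of odd length to be letter-to-letter,
so that the word itself or its complement occurs in `t`.
-/

namespace ThueMorse

open Letter

section InfiniteWords

variable {A B : Type*} {x : ℕ → B}

/-- The finite word `u` is the block of letters of the infinite word `x` that starts at
position `m`. -/
def OccursAt (x : ℕ → B) (m : ℕ) (u : List B) : Prop :=
  ∀ j (h : j < u.length), x (m + j) = u[j]

/-- The finite word `u`, possibly empty, is a factor of the infinite word `x`. For nonempty words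
this is `IsSegment`, with lists in place of elements of the free semigroup. -/
def Occurs (x : ℕ → B) (u : List B) : Prop := ∃ m, OccursAt x m u

theorem occursAt_nil (m : ℕ) : OccursAt x m [] := by
  simp [OccursAt]

theorem occursAt_cons {m : ℕ} {c : B} {u : List B} :
    OccursAt x m (c :: u) ↔ x m = c ∧ OccursAt x (m + 1) u := by
  refine ⟨fun h => ⟨h 0 (by simp), fun j hj => ?_⟩, fun h j hj => ?_⟩
  · rw [add_assoc, add_comm 1]
    exact h (j + 1) (by simpa using hj)
  · rcases j with _ | j
    · exact h.1
    · simpa [add_assoc, add_comm 1] using h.2 j (by simpa using hj)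

theorem occursAt_append {m : ℕ} {u v : List B} :
    OccursAt x m (u ++ v) ↔ OccursAt x m u ∧ OccursAt x (m + u.length) v := by
  induction u generalizing m with
  | nil => simp [occursAt_nil]
  | cons c u ih => simp [occursAt_cons, ih, and_assoc, add_assoc, add_comm 1]

theorem Occurs.of_infix {u v : List B} (h : Occurs x v) (huv : u <:+: v) : Occurs x u := by
  obtain ⟨s, t, rfl⟩ := huv
  obtain ⟨m, hm⟩ := h
  exact ⟨_, (occursAt_append.1 (occursAt_append.1 hm).1).2⟩

theorem OccursAt.eq_add_of_square {m : ℕ} {u : List B} (h : OccursAt x m (u ++ u)) :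
    ∀ j < u.length, x (m + j) = x (m + j + u.length) := by
  intro j hj
  rw [occursAt_append] at h
  rw [h.1 j hj, add_right_comm, h.2 j hj]

theorem letters_injective : Function.Injective (letters (A := A)) := by
  rintro ⟨c, u⟩ ⟨d, v⟩ h
  simpa [letters] using h

theorem letters_ne_nil (u : FreeSemigroup A) : letters u ≠ [] :=
  List.cons_ne_nil _ _

theorem exists_letters_eq {u : List A} (hu : u ≠ []) : ∃ v : FreeSemigroup A, letters v = u := by
  obtain ⟨c, u, rfl⟩ := List.exists_cons_of_ne_nil hu
  exact ⟨⟨c, u⟩, rfl⟩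

theorem letters_map (φ : FreeSemigroup A →ₙ* FreeSemigroup B) (w : FreeSemigroup A) :
    letters (φ w) = (letters w).flatMap fun c => letters (φ (FreeSemigroup.of c)) := by
  induction w using FreeSemigroup.recOnMul with
  | ih1 c => simp [letters]
  | ih2 u v hu hv => rw [map_mul, letters_mul, hu, hv, letters_mul, List.flatMap_append]

theorem isSegment_iff_occurs {u : FreeSemigroup B} : IsSegment x u ↔ Occurs x (letters u) := by
  refine exists_congr fun m => ?_
  simp [List.ext_getElem_iff, OccursAt, letters_length, eq_comm]

/-- The word `w` is a pattern of the infinite word `x`: some image of `w`, in which each letter is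
replaced by a nonempty word, is a factor of `x`. -/
def IsPattern (x : ℕ → B) (w : List A) : Prop :=
  ∃ f : A → List B, (∀ c, f c ≠ []) ∧ Occurs x (w.flatMap f)

theorem isUnavoidableIn_iff_isPattern {w : FreeSemigroup A} :
    IsUnavoidableIn w x ↔ IsPattern x (letters w) := by
  refine not_not.trans ⟨?_, ?_⟩
  · rintro ⟨φ, hφ⟩
    exact ⟨_, fun c => letters_ne_nil _, letters_map φ w ▸ isSegment_iff_occurs.1 hφ⟩
  · rintro ⟨f, hf, h⟩
    choose g hg using fun c => exists_letters_eq (hf c)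
    refine ⟨FreeSemigroup.lift g, isSegment_iff_occurs.2 ?_⟩
    simpa [letters_map, hg] using h

theorem Occurs.isPattern {w : List B} (h : Occurs x w) : IsPattern x w :=
  ⟨fun c => [c], by simp, by simpa using h⟩

theorem Occurs.flatMap_of_infix {f : A → List B} {u w : List A} (h : Occurs x (w.flatMap f))
    (hu : u <:+: w) : Occurs x (u.flatMap f) := by
  obtain ⟨s, t, rfl⟩ := hu
  exact h.of_infix ⟨s.flatMap f, t.flatMap f, by simp only [List.flatMap_append]⟩

theorem IsPattern.of_infix {u w : List A} (h : IsPattern x w) (hu : u <:+: w) : IsPattern x u := by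
  obtain ⟨f, hf, hw⟩ := h
  exact ⟨f, hf, hw.flatMap_of_infix hu⟩

end InfiniteWords

section Recurrence

/-- The letter other than the given one. -/
def Letter.swap : Letter → Letter
  | a => b
  | b => a

@[simp]
theorem Letter.swap_swap (c : Letter) : c.swap.swap = c := by
  cases c <;> rfl

theorem Letter.swap_ne (c : Letter) : c.swap ≠ c := by
  cases c <;> decide

theorem Letter.ne_iff_swap_eq {c d : Letter} : c ≠ d ↔ c.swap = d := by
  cases c <;> cases d <;> decide

theorem Letter.eq_or_eq_swap (c d : Letter) : d = c ∨ d = c.swap := by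
  cases c <;> cases d <;> decide

theorem letters_mu (u : Word) :
    letters (mu u) = (letters u).flatMap fun c => [c, c.swap] := by
  rw [letters_map]
  refine congrArg (List.flatMap · _) (funext fun c => ?_)
  cases c <;> rfl

theorem getElem?_flatMap_pair {A : Type*} (f : A → A) (u : List A) (n : ℕ) :
    (u.flatMap fun c => [c, f c])[2 * n]? = u[n]? ∧
      (u.flatMap fun c => [c, f c])[2 * n + 1]? = u[n]?.map f := by
  induction u generalizing n with
  | nil => simp
  | cons c u ih =>
    cases n with
    | zero => simp
    | succ n => simpa [mul_add] using ih n

theorem getElem?_letters_iterate_mu {n k : ℕ} (h : n < 2 ^ k) :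
    (letters (mu^[k] wa))[n]? = some (thueMorse n) := by
  simp [prefix_thueMorse, h]

theorem occursAt_iterate_mu (k : ℕ) : OccursAt thueMorse 0 (letters (mu^[k] wa)) := by
  simp [OccursAt, prefix_thueMorse]

theorem occurs_of_infix_iterate_mu {k : ℕ} {u : List Letter} (h : u <:+: letters (mu^[k] wa)) :
    Occurs thueMorse u :=
  Occurs.of_infix ⟨0, occursAt_iterate_mu k⟩ h

theorem thueMorse_two_mul (n : ℕ) : thueMorse (2 * n) = thueMorse n := by
  have hn : n < 2 ^ n := Nat.lt_two_pow_self
  have h := getElem?_letters_iterate_mu (n := 2 * n) (k := n + 1) (by omega)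
  rw [Function.iterate_succ_apply', letters_mu, (getElem?_flatMap_pair _ _ _).1,
    getElem?_letters_iterate_mu hn] at h
  simpa using h.symm

theorem thueMorse_two_mul_add_one (n : ℕ) : thueMorse (2 * n + 1) = (thueMorse n).swap := by
  have hn : n < 2 ^ n := Nat.lt_two_pow_self
  have h := getElem?_letters_iterate_mu (n := 2 * n + 1) (k := n + 1) (by omega)
  rw [Function.iterate_succ_apply', letters_mu, (getElem?_flatMap_pair _ _ _).2,
    getElem?_letters_iterate_mu hn] at h
  simpa using h.symm

theorem thueMorse_add_two_pow {k n : ℕ} (h : n < 2 ^ k) :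
    thueMorse (n + 2 ^ k) = (thueMorse n).swap := by
  induction k generalizing n with
  | zero =>
    obtain rfl : n = 0 := by simpa using h
    exact thueMorse_two_mul_add_one 0
  | succ k ih =>
    rw [pow_succ'] at h ⊢
    obtain ⟨m, rfl | rfl⟩ := Nat.even_or_odd' n
    · rw [← mul_add, thueMorse_two_mul, thueMorse_two_mul, ih (by omega)]
    · rw [add_right_comm, ← mul_add, thueMorse_two_mul_add_one, thueMorse_two_mul_add_one,
        ih (by omega)]

theorem Occurs.map_swap {u : List Letter} (h : Occurs thueMorse u) :
    Occurs thueMorse (u.map swap) := by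
  obtain ⟨m, hm⟩ := h
  refine ⟨m + 2 ^ (m + u.length), fun j hj => ?_⟩
  rw [List.length_map] at hj
  have : m + u.length < 2 ^ (m + u.length) := Nat.lt_two_pow_self
  rw [List.getElem_map, ← hm j hj, add_right_comm, thueMorse_add_two_pow (by omega)]

end Recurrence

section Squares

theorem thueMorse_ne_succ_of_even {n : ℕ} (h : Even n) : thueMorse n ≠ thueMorse (n + 1) := by
  obtain ⟨m, rfl⟩ := h.exists_two_nsmul
  rw [smul_eq_mul, thueMorse_two_mul, thueMorse_two_mul_add_one]
  exact (swap_ne _).symm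

theorem thueMorse_eq_succ_of_ne {m : ℕ} (h : thueMorse (2 * m + 1) ≠ thueMorse (2 * m + 2)) :
    thueMorse m = thueMorse (m + 1) := by
  rwa [ne_iff_swap_eq, thueMorse_two_mul_add_one, swap_swap, show 2 * m + 2 = 2 * (m + 1) by ring,
    thueMorse_two_mul] at h

theorem exists_thueMorse_eq_succ (i : ℕ) : ∃ j < 4, thueMorse (i + j) = thueMorse (i + j + 1) := by
  by_contra! alternating
  obtain ⟨m, h₁, h₂⟩ : ∃ m, thueMorse m = thueMorse (m + 1) ∧
      thueMorse (m + 1) = thueMorse (m + 1 + 1) := by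
    obtain ⟨m, rfl | rfl⟩ := Nat.even_or_odd' i
    · exact ⟨m, thueMorse_eq_succ_of_ne (alternating 1 (by simp)),
        thueMorse_eq_succ_of_ne (alternating 3 (by simp))⟩
    · exact ⟨m, thueMorse_eq_succ_of_ne (alternating 0 (by simp)),
        thueMorse_eq_succ_of_ne (alternating 2 (by simp))⟩
  rcases Nat.even_or_odd m with hm | hm
  · exact thueMorse_ne_succ_of_even hm h₁
  · exact thueMorse_ne_succ_of_even hm.add_one h₂

section OddRoot

variable {i p : ℕ} (hp : Odd p) (h : ∀ j < p, thueMorse (i + j) = thueMorse (i + j + p))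

include hp h

/-- One of the two copies of a pair of consecutive letters starts at an even position. -/
theorem thueMorse_ne_succ_of_odd_square {j : ℕ} (hj : j + 1 < p) :
    thueMorse (i + j) ≠ thueMorse (i + j + 1) := by
  rcases Nat.even_or_odd (i + j) with heven | hodd
  · exact thueMorse_ne_succ_of_even heven
  · rw [h j (by omega), add_assoc i j 1, h (j + 1) hj, ← add_assoc, add_right_comm _ 1 p]
    exact thueMorse_ne_succ_of_even (hodd.add_odd hp)

theorem eq_one_or_eq_three_of_odd_square : p = 1 ∨ p = 3 := by
  have : p < 5 := by
    by_contra! hp5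
    obtain ⟨j, hj, heq⟩ := exists_thueMorse_eq_succ i
    exact thueMorse_ne_succ_of_odd_square hp h (by omega) heq
  obtain ⟨k, rfl⟩ := hp
  omega

theorem odd_of_odd_square : Odd i := by
  by_contra! hi
  rw [Nat.not_odd_iff_even] at hi
  have h₀ := h 0 hp.pos
  rcases eq_one_or_eq_three_of_odd_square hp h with rfl | rfl
  · exact thueMorse_ne_succ_of_even hi h₀
  · have h₁ := thueMorse_ne_succ_of_odd_square hp h (j := 0) (by simp)
    have h₂ := thueMorse_ne_succ_of_odd_square hp h (j := 1) (by simp)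
    have h₃ := thueMorse_ne_succ_of_even (hi.add even_two)
    rw [ne_iff_swap_eq] at h₁ h₂ h₃
    simp only [add_zero, add_assoc, Nat.reduceAdd] at h₀ h₁ h₂ h₃
    rw [← h₃, ← h₂, ← h₁, swap_swap] at h₀
    exact swap_ne _ h₀.symm

end OddRoot

/-- A square with even root at an odd position would extend by one letter to the left, because its
blocks `x x̄` are then split in the same way in both copies; halving the resulting overlap gives
squares with half the root and consecutive centres. -/
theorem even_add_of_square {i p : ℕ} (hp : 0 < p)
    (h : ∀ j < p, thueMorse (i + j) = thueMorse (i + j + p)) : Even (i + p) := by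
  induction p using Nat.strong_induction_on generalizing i with
  | _ p ih =>
    rcases Nat.even_or_odd' p with ⟨q, rfl | rfl⟩
    swap
    · exact (odd_of_odd_square (odd_two_mul_add_one q) h).add_odd (odd_two_mul_add_one q)
    rcases Nat.even_or_odd' i with ⟨m, rfl | rfl⟩
    · exact (even_two_mul m).add (even_two_mul q)
    have overlap : ∀ j ≤ q, thueMorse (m + j) = thueMorse (m + j + q) := by
      intro j hj
      rcases hj.lt_or_eq with hj | rfl
      · have := h (2 * j) (by omega)
        rw [show 2 * m + 1 + 2 * j = 2 * (m + j) + 1 by ring, add_right_comm _ 1, ← mul_add,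
          thueMorse_two_mul_add_one, thueMorse_two_mul_add_one] at this
        simpa using congrArg swap this
      · have := h (2 * j - 1) (by omega)
        rwa [show 2 * m + 1 + (2 * j - 1) = 2 * (m + j) by omega, ← mul_add,
          thueMorse_two_mul, thueMorse_two_mul] at this
    have even_left : Even (m + q) := ih q (by omega) (by omega) fun j hj => overlap j hj.le
    have even_right : Even (m + 1 + q) := ih q (by omega) (by omega) fun j hj => by
      rw [add_assoc m 1 j, add_comm 1 j]
      exact overlap (j + 1) hj
    rw [add_right_comm, Nat.even_add_one] at even_right
    exact absurd even_left even_right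

variable {m : ℕ} {u : List Letter}

theorem OccursAt.even_of_square (h : OccursAt thueMorse m (u ++ u)) (hu : u ≠ []) :
    Even (m + u.length) :=
  even_add_of_square (List.length_pos_iff.2 hu) h.eq_add_of_square

theorem Occurs.eq_of_odd_square (h : Occurs thueMorse (u ++ u)) (hu : Odd u.length) :
    ∃ c, u = [c] ∨ u = [c, c.swap, c] := by
  obtain ⟨m, hm⟩ := h
  have hper := hm.eq_add_of_square
  rw [occursAt_append] at hm
  rcases eq_one_or_eq_three_of_odd_square hu hper with hlen | hlen
  · obtain ⟨c, rfl⟩ := List.length_eq_one_iff.1 hlen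
    exact ⟨c, .inl rfl⟩
  · obtain ⟨c, d, e, rfl⟩ := List.length_eq_three.1 hlen
    have h₁ := thueMorse_ne_succ_of_odd_square hu hper (j := 0) (by simp)
    have h₂ := thueMorse_ne_succ_of_odd_square hu hper (j := 1) (by simp)
    simp only [occursAt_cons, add_zero, ne_iff_swap_eq] at hm h₁ h₂
    obtain ⟨⟨rfl, rfl, rfl, -⟩, -⟩ := hm
    exact ⟨thueMorse m, .inr (by simp [← h₂, ← h₁])⟩

/-- An overlap contains two squares with consecutive centres. -/
theorem not_occurs_overlap (c : Letter) (u : List Letter) :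
    ¬ Occurs thueMorse (c :: u ++ c :: u ++ [c]) := by
  rintro ⟨m, h⟩
  have even_left : Even (m + (c :: u).length) :=
    (occursAt_append.1 h).1.even_of_square (by simp)
  have even_right : Even (m + 1 + (u ++ [c]).length) := by
    have h' : OccursAt thueMorse m (c :: ((u ++ [c]) ++ (u ++ [c]))) := by simpa using h
    exact (occursAt_cons.1 h').2.even_of_square (by simp)
  simp only [List.length_cons, List.length_append, List.length_nil, Nat.even_iff] at *
  omega

theorem not_occurs_ccdcc (c d : Letter) : ¬ Occurs thueMorse [c, c, d, c, c] := by
  rintro ⟨m, h⟩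
  have even_left : Even (m + 1) :=
    (occursAt_append (u := [c, c]).1 h).1.even_of_square (u := [c]) (by simp)
  have even_right : Even (m + 3 + 1) :=
    (occursAt_append (u := [c, c, d]).1 h).2.even_of_square (u := [c]) (by simp)
  rw [Nat.even_iff] at *
  omega

section Adjacent

variable {c d : Letter} {v : List Letter}

/-- The letters `c` and `d` form a block `x x̄`. -/
theorem ne_of_odd_square_append (hu : Odd u.length) (hc : u.getLast? = some c)
    (hd : v.head? = some d) (h : Occurs thueMorse (u ++ u ++ v)) : c ≠ d := by
  obtain ⟨s, rfl⟩ := List.getLast?_eq_some_iff.1 hc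
  obtain ⟨t, rfl⟩ := List.head?_eq_some_iff.1 hd
  obtain ⟨m, h⟩ := h
  have center := (occursAt_append.1 h).1.even_of_square (by simp)
  simp only [occursAt_append, occursAt_cons, List.length_append, List.length_singleton] at *
  have block : Even (m + (s.length + 1) + s.length) := by
    rw [Nat.odd_iff] at hu
    rw [Nat.even_iff] at *
    omega
  rw [← h.1.2.2.1, ← h.2.1]
  convert thueMorse_ne_succ_of_even block using 2
  ring

theorem ne_of_append_odd_square (hu : Odd u.length) (hc : v.getLast? = some c)
    (hd : u.head? = some d) (h : Occurs thueMorse (v ++ (u ++ u))) : c ≠ d := by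
  obtain ⟨s, rfl⟩ := List.getLast?_eq_some_iff.1 hc
  obtain ⟨t, rfl⟩ := List.head?_eq_some_iff.1 hd
  obtain ⟨m, h⟩ := h
  have center := (occursAt_append.1 h).2.even_of_square (by simp)
  simp only [occursAt_append, occursAt_cons, List.length_append, List.length_cons,
    List.length_nil] at *
  have block : Even (m + s.length) := by
    rw [Nat.odd_iff] at hu
    rw [Nat.even_iff] at *
    omega
  rw [← h.1.2.1, ← h.2.1.1]
  exact thueMorse_ne_succ_of_even block

end Adjacent

end Squares

section Halving

/-- The letters of a list at even positions. It is used to undo `μ`, which puts the letters of a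
word at the even positions of its image. -/
def evenLetters {A : Type*} : List A → List A
  | [] => []
  | [c] => [c]
  | c :: _ :: u => c :: evenLetters u

variable {A B : Type*}

theorem evenLetters_append {u v : List A} (hu : Even u.length) :
    evenLetters (u ++ v) = evenLetters u ++ evenLetters v := by
  induction u using evenLetters.induct with
  | case1 => rfl
  | case2 c => simp at hu
  | case3 c d u ih => simp [evenLetters, ih (by simpa [Nat.even_add_one] using hu)]

theorem two_mul_length_evenLetters {u : List A} (hu : Even u.length) :
    2 * (evenLetters u).length = u.length := by
  induction u using evenLetters.induct with
  | case1 => rfl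
  | case2 c => simp at hu
  | case3 c d u ih =>
    have := ih (by simpa [Nat.even_add_one] using hu)
    simp only [evenLetters, List.length_cons]
    omega

theorem evenLetters_ne_nil {u : List A} (hu : u ≠ []) : evenLetters u ≠ [] := by
  induction u using evenLetters.induct <;> simp_all [evenLetters]

theorem even_length_flatMap {f : A → List B} {w : List A} (hf : ∀ c ∈ w, Even (f c).length) :
    Even (w.flatMap f).length := by
  induction w with
  | nil => simp
  | cons c w ih =>
    rw [List.forall_mem_cons] at hf
    rw [List.flatMap_cons, List.length_append]
    exact hf.1.add (ih hf.2)

theorem evenLetters_flatMap {f : A → List B} {w : List A} (hf : ∀ c ∈ w, Even (f c).length) :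
    evenLetters (w.flatMap f) = w.flatMap fun c => evenLetters (f c) := by
  induction w with
  | nil => rfl
  | cons c w ih =>
    rw [List.forall_mem_cons] at hf
    rw [List.flatMap_cons, evenLetters_append hf.1, ih hf.2, List.flatMap_cons]

theorem OccursAt.evenLetters {m : ℕ} {u : List Letter} (h : OccursAt thueMorse (2 * m) u) :
    OccursAt thueMorse m (evenLetters u) := by
  induction u using evenLetters.induct generalizing m with
  | case1 => exact occursAt_nil m
  | case2 c => simpa [ThueMorse.evenLetters, occursAt_cons, occursAt_nil, thueMorse_two_mul] using h
  | case3 c d u ih =>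
    rw [occursAt_cons, occursAt_cons, thueMorse_two_mul] at h
    exact occursAt_cons.2 ⟨h.1, ih h.2.2⟩

variable {f : A → List Letter} {w : List A} {c : A}

theorem Occurs.flatMap_evenLetters (hf : ∀ x, f x ≠ []) (heven : ∀ x ∈ w, Even (f x).length)
    (hc : [c, c] <:+: w) (h : Occurs thueMorse (w.flatMap f)) :
    Occurs thueMorse (w.flatMap fun x => evenLetters (f x)) := by
  obtain ⟨m, hm⟩ := h
  have hm_even : Even m := by
    obtain ⟨s, t, rfl⟩ := hc
    have hs : Even (s.flatMap f).length := even_length_flatMap fun x hx => heven x (by simp [hx])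
    have hsq : OccursAt thueMorse (m + (s.flatMap f).length) (f c ++ f c) := by
      simp only [List.flatMap_append, List.append_assoc] at hm
      rw [← List.append_assoc, occursAt_append, occursAt_append] at hm
      simpa using hm.1.2
    have center := hsq.even_of_square (hf c)
    exact (Nat.even_add.1 ((Nat.even_add.1 center).2 (heven c (by simp)))).2 hs
  obtain ⟨q, rfl⟩ := hm_even.exists_two_nsmul
  rw [← evenLetters_flatMap heven]
  exact ⟨q, hm.evenLetters⟩

/-- Infinite descent: halve the images of the letters as long as all of them have even length. -/
theorem IsPattern.exists_odd_image (h : IsPattern thueMorse w) (hc : [c, c] <:+: w) :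
    ∃ f : A → List Letter, (∀ x, f x ≠ []) ∧ Occurs thueMorse (w.flatMap f) ∧
      ∃ x ∈ w, Odd (f x).length := by
  obtain ⟨f, hf, h⟩ := h
  induction hn : (w.flatMap f).length using Nat.strong_induction_on generalizing f with
  | _ n ih =>
    by_cases hodd : ∃ x ∈ w, Odd (f x).length
    · exact ⟨f, hf, h, hodd⟩
    have heven : ∀ x ∈ w, Even (f x).length := by simpa using hodd
    refine ih _ ?_ _ (fun x => evenLetters_ne_nil (hf x))
      (h.flatMap_evenLetters hf heven hc) rfl
    have hlen := two_mul_length_evenLetters (even_length_flatMap heven)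
    rw [evenLetters_flatMap heven] at hlen
    have hpos : 0 < (w.flatMap f).length := by
      obtain ⟨s, t, rfl⟩ := hc
      simp [List.length_pos_iff, hf]
    omega

end Halving

section Avoidance

variable {A : Type*}

theorem not_isPattern_overlap (c : A) (u : List A) :
    ¬ IsPattern thueMorse (c :: u ++ c :: u ++ [c]) := by
  rintro ⟨f, hf, h⟩
  obtain ⟨d, v, hv⟩ := List.exists_cons_of_ne_nil (hf c)
  exact not_occurs_overlap d (v ++ u.flatMap f) (h.of_infix ⟨[], v, by simp [hv]⟩)

theorem not_isPattern_ccdccd (c d : A) : ¬ IsPattern thueMorse [c, c, d, c, c, d] := by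
  intro h
  obtain ⟨f, hf, ⟨m, hm⟩, hodd⟩ := h.exists_odd_image (c := c) ⟨[], [d, c, c, d], rfl⟩
  have hm : OccursAt thueMorse m ((f c ++ f c ++ f d) ++ (f c ++ f c ++ f d)) := by
    simpa using hm
  have center := hm.even_of_square (by simp [hf])
  simp only [occursAt_append (v := f d), occursAt_append (u := _ ++ _ ++ _)] at hm
  have center_left := hm.1.1.even_of_square (hf c)
  have center_right := hm.2.1.even_of_square (hf c)
  simp only [List.mem_cons, List.not_mem_nil, or_false, exists_eq_or_imp, exists_eq_left] at hodd
  simp only [List.length_append, Nat.even_iff, Nat.odd_iff] at *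
  omega

theorem not_isPattern_dccdcc (c d : A) : ¬ IsPattern thueMorse [d, c, c, d, c, c] := by
  intro h
  obtain ⟨f, hf, ⟨m, hm⟩, hodd⟩ := h.exists_odd_image (c := c) ⟨[d], [d, c, c], rfl⟩
  have hm : OccursAt thueMorse m ((f d ++ (f c ++ f c)) ++ (f d ++ (f c ++ f c))) := by
    simpa using hm
  have center := hm.even_of_square (by simp [hf])
  simp only [occursAt_append (u := f d), occursAt_append (u := _ ++ (_ ++ _))] at hm
  have center_left := hm.1.2.even_of_square (hf c)
  have center_right := hm.2.2.even_of_square (hf c)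
  simp only [List.mem_cons, List.not_mem_nil, or_false, exists_eq_or_imp, exists_eq_left] at hodd
  simp only [List.length_append, Nat.even_iff, Nat.odd_iff] at *
  omega

theorem not_isPattern_ccddccdd (c d : A) : ¬ IsPattern thueMorse [c, c, d, d, c, c, d, d] := by
  intro h
  obtain ⟨f, hf, ⟨m, hm⟩, hodd⟩ := h.exists_odd_image (c := c) ⟨[], [d, d, c, c, d, d], rfl⟩
  have hm : OccursAt thueMorse m
      (((f c ++ f c) ++ (f d ++ f d)) ++ ((f c ++ f c) ++ (f d ++ f d))) := by
    simpa using hm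
  have center := hm.even_of_square (by simp [hf])
  simp only [occursAt_append (u := _ ++ _)] at hm
  have center_left := hm.1.1.even_of_square (hf c)
  have center_right := hm.1.2.even_of_square (hf d)
  simp only [List.mem_cons, List.not_mem_nil, or_false, exists_eq_or_imp, exists_eq_left] at hodd
  simp only [List.length_append, Nat.even_iff, Nat.odd_iff] at *
  omega

/-- Words that are not patterns of `t`, chosen so that a word of length at least `9` that avoids
them as factors is rigid (see `IsRigid`). -/
def forbidden : List (List Letter) :=
  [a, b].flatMap fun c =>
    [[c, c, c], [c, c.swap, c, c.swap, c], [c, c, c.swap, c, c, c.swap],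
      [c.swap, c, c, c.swap, c, c], [c, c, c.swap, c.swap, c, c, c.swap, c.swap]]

theorem not_isPattern_of_mem_forbidden {u : List Letter} (hu : u ∈ forbidden) :
    ¬ IsPattern thueMorse u := by
  obtain ⟨c, -, hu⟩ := List.mem_flatMap.1 hu
  simp only [List.mem_cons, List.not_mem_nil, or_false] at hu
  rcases hu with rfl | rfl | rfl | rfl | rfl
  · exact not_isPattern_overlap c []
  · exact not_isPattern_overlap c [c.swap]
  · exact not_isPattern_ccdccd c c.swap
  · exact not_isPattern_dccdcc c c.swap
  · exact not_isPattern_ccddccdd c c.swap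

/-- The words of length `n` over the alphabet `S` that have no factor in `F`, computed by adding
letters on the left and discarding the words that have a prefix in `F`. -/
def wordsAvoiding [DecidableEq A] (S : List A) (F : List (List A)) : ℕ → List (List A)
  | 0 => [[]]
  | n + 1 => S.flatMap fun c =>
      ((wordsAvoiding S F n).map (c :: ·)).filter fun w => ∀ u ∈ F, ¬ u <+: w

theorem mem_wordsAvoiding [DecidableEq A] {S : List A} {F : List (List A)} {w : List A}
    (hS : ∀ c ∈ w, c ∈ S) (hF : ∀ u ∈ F, ¬ u <:+: w) : w ∈ wordsAvoiding S F w.length := by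
  induction w with
  | nil => simp [wordsAvoiding]
  | cons c w ih =>
    rw [List.forall_mem_cons] at hS
    have hw : w ∈ wordsAvoiding S F w.length :=
      ih hS.2 fun u hu h => hF u hu (h.trans (List.suffix_cons c w).isInfix)
    have hprefix : ∀ u ∈ F, ¬ u <+: c :: w := fun u hu h => hF u hu h.isInfix
    simpa [wordsAvoiding, hw, hS.1] using hprefix

theorem IsPattern.mem_wordsAvoiding {w : List Letter} (h : IsPattern thueMorse w) :
    w ∈ wordsAvoiding [a, b] forbidden w.length :=
  ThueMorse.mem_wordsAvoiding (fun c _ => by cases c <;> simp) fun _ hu huw =>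
    not_isPattern_of_mem_forbidden hu (h.of_infix huw)

end Avoidance

section Rigidity

/-- A word with enough squares to force every image of it in `t`, in which some letter has an image
of odd length, to be letter-to-letter. The last condition transfers the odd length to the other
letter, `cc` and `c̄c̄` then restrict both images to `x` or `x x̄ x`, and `cc̄c` or `c̄cc̄` excludes
the images of length three. -/
def IsRigid (w : List Letter) : Prop :=
  ∃ c ∈ [a, b], [c, c] <:+: w ∧ [c.swap, c.swap] <:+: w ∧
    ([c, c.swap, c] <:+: w ∨ [c.swap, c, c.swap] <:+: w) ∧
    ([c, c, c.swap, c.swap] <:+: w ∨ [c, c, c.swap, c, c.swap] <:+: w ∨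
      [c.swap, c, c.swap, c, c] <:+: w)

instance (w : List Letter) : Decidable (IsRigid w) := by
  unfold IsRigid
  infer_instance

theorem IsRigid.of_infix {u w : List Letter} (h : IsRigid u) (huw : u <:+: w) : IsRigid w := by
  obtain ⟨c, hc, hcc, hdd, haba, hparity⟩ := h
  exact ⟨c, hc, hcc.trans huw, hdd.trans huw, haba.imp (·.trans huw) (·.trans huw),
    hparity.imp (·.trans huw) (·.imp (·.trans huw) (·.trans huw))⟩

variable {w u v : List Letter} {f : Letter → List Letter} {c x y : Letter}

theorem Occurs.even_length_iff_of_uuvv (h : Occurs thueMorse (u ++ u ++ (v ++ v))) (hu : u ≠ [])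
    (hv : v ≠ []) : Even u.length ↔ Even v.length := by
  obtain ⟨m, h⟩ := h
  rw [occursAt_append] at h
  have center_left := h.1.even_of_square hu
  have center_right := h.2.even_of_square hv
  rw [List.length_append] at center_right
  grind

theorem Occurs.even_length_iff_of_uuvuv (h : Occurs thueMorse (u ++ u ++ (v ++ (u ++ v))))
    (hu : u ≠ []) : Even u.length ↔ Even v.length := by
  obtain ⟨m, h⟩ := h
  have h' : OccursAt thueMorse m (u ++ ((u ++ v) ++ (u ++ v))) := by simpa using h
  have center_left := (occursAt_append.1 h).1.even_of_square hu
  have center_right := (occursAt_append.1 h').2.even_of_square (by simp [hu])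
  rw [List.length_append] at center_right
  grind

theorem Occurs.even_length_iff_of_vuvuu (h : Occurs thueMorse (v ++ (u ++ v) ++ (u ++ u)))
    (hu : u ≠ []) : Even u.length ↔ Even v.length := by
  obtain ⟨m, h⟩ := h
  have h' : OccursAt thueMorse m (((v ++ u) ++ (v ++ u)) ++ u) := by simpa using h
  have center_left := (occursAt_append.1 h').1.even_of_square (by simp [hu])
  have center_right := (occursAt_append.1 h).2.even_of_square hu
  simp only [List.length_append] at center_left center_right
  grind

theorem swap_eq_of_occurs (hu : u = [x] ∨ u = [x, x.swap, x]) (hv : v = [y] ∨ v = [y, y.swap, y])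
    (h : Occurs thueMorse (u ++ u ++ v) ∨ Occurs thueMorse (v ++ (u ++ u))) : x.swap = y := by
  have hodd : Odd u.length := by rcases hu with rfl | rfl <;> simp [Nat.odd_iff]
  have first_u : u.head? = some x := by rcases hu with rfl | rfl <;> rfl
  have last_u : u.getLast? = some x := by rcases hu with rfl | rfl <;> rfl
  have first_v : v.head? = some y := by rcases hv with rfl | rfl <;> rfl
  have last_v : v.getLast? = some y := by rcases hv with rfl | rfl <;> rfl
  rw [← ne_iff_swap_eq]
  rcases h with h | h
  · exact ne_of_odd_square_append hodd last_u first_v h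
  · exact (ne_of_append_odd_square hodd last_v first_u h).symm

theorem eq_singleton_of_occurs_uvu (hu : u = [x] ∨ u = [x, x.swap, x])
    (hv : v = [x.swap] ∨ v = [x.swap, x, x.swap]) (h : Occurs thueMorse (u ++ v ++ u)) :
    u = [x] ∧ v = [x.swap] := by
  rcases hu with rfl | rfl <;> rcases hv with rfl | rfl
  · exact ⟨rfl, rfl⟩
  all_goals exact (not_occurs_overlap x [x.swap] (h.of_infix ⟨[], _, rfl⟩)).elim

theorem Occurs.of_flatMap_singletons (h : Occurs thueMorse (w.flatMap f)) (hc : f c = [x])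
    (hd : f c.swap = [x.swap]) : Occurs thueMorse w := by
  rcases eq_or_ne c x with rfl | hcx
  · obtain rfl : f = fun e => [e] := by
      funext e
      rcases c.eq_or_eq_swap e with rfl | rfl <;> assumption
    simpa using h
  · obtain rfl := ne_iff_swap_eq.1 hcx
    obtain rfl : f = fun e => [e.swap] := by
      funext e
      rcases c.eq_or_eq_swap e with rfl | rfl <;> simp [*]
    simpa [List.map_flatMap] using h.map_swap

theorem IsRigid.occurs (hw : IsRigid w) (h : IsPattern thueMorse w) : Occurs thueMorse w := by
  obtain ⟨c, -, hcc, hdd, haba, hparity⟩ := hw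
  obtain ⟨f, hf, h, e, -, he⟩ := h.exists_odd_image hcc
  have image : ∀ {u}, u <:+: w → Occurs thueMorse (u.flatMap f) := h.flatMap_of_infix
  have same_parity : Even (f c).length ↔ Even (f c.swap).length := by
    rcases hparity with hu | hu | hu
    · exact Occurs.even_length_iff_of_uuvv (by simpa using image hu) (hf c) (hf c.swap)
    · exact Occurs.even_length_iff_of_uuvuv (by simpa using image hu) (hf c)
    · exact Occurs.even_length_iff_of_vuvuu (by simpa using image hu) (hf c)
  obtain ⟨odd_c, odd_d⟩ : Odd (f c).length ∧ Odd (f c.swap).length := by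
    simp only [← Nat.not_even_iff_odd] at he ⊢
    rcases c.eq_or_eq_swap e with rfl | rfl <;> tauto
  obtain ⟨x, hx⟩ := Occurs.eq_of_odd_square (by simpa using image hcc) odd_c
  obtain ⟨y, hy⟩ := Occurs.eq_of_odd_square (by simpa using image hdd) odd_d
  obtain rfl : x.swap = y := by
    refine swap_eq_of_occurs hx hy ?_
    rcases hparity with hu | hu | hu
    · exact .inl (by simpa using image (.trans ⟨[], [c.swap], rfl⟩ hu : [c, c, c.swap] <:+: w))
    · exact .inl (by simpa using image (.trans ⟨[], [c, c.swap], rfl⟩ hu : [c, c, c.swap] <:+: w))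
    · exact .inr (by simpa using image (.trans ⟨[c.swap, c], [], rfl⟩ hu : [c.swap, c, c] <:+: w))
  obtain ⟨hfc, hfd⟩ : f c = [x] ∧ f c.swap = [x.swap] := by
    rcases haba with hu | hu
    · exact eq_singleton_of_occurs_uvu hx (by simpa using hy) (by simpa using image hu)
    · exact (eq_singleton_of_occurs_uvu hy (by simpa using hx) (by simpa using image hu)).symm.imp
        (by simp) id
  exact h.of_flatMap_singletons hfc hfd

end Rigidity

section Classification

theorem isPattern_ccdcc (c : Letter) : IsPattern thueMorse [c, c, c.swap, c, c] := by
  have h : [c, c, c.swap, c.swap, c, c] <:+: letters (mu^[5] wa) := by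
    cases c <;> decide +kernel
  refine ⟨fun x => if x = c then [x] else [x, x], fun x => ?_, ?_⟩
  · by_cases hx : x = c <;> simp [hx]
  · simpa [swap_ne] using occurs_of_infix_iterate_mu h

/-- Every factor of `t` of length at most `8` occurs in `μ⁵(a)`. -/
theorem infix_or_eq_ccdcc_or_isRigid : ∀ n < 9, ∀ w ∈ wordsAvoiding [a, b] forbidden n,
    w <:+: letters (mu^[5] wa) ∨ (∃ c ∈ [a, b], w = [c, c, c.swap, c, c]) ∨ IsRigid w := by
  decide +kernel

theorem isRigid_of_mem_wordsAvoiding : ∀ w ∈ wordsAvoiding [a, b] forbidden 9, IsRigid w := by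
  decide +kernel

theorem isPattern_thueMorse_iff {w : List Letter} :
    IsPattern thueMorse w ↔ Occurs thueMorse w ∨ ∃ c, w = [c, c, c.swap, c, c] := by
  refine ⟨fun h => ?_, ?_⟩
  · rcases lt_or_ge w.length 9 with hlen | hlen
    · rcases infix_or_eq_ccdcc_or_isRigid _ hlen w h.mem_wordsAvoiding with hw | ⟨c, -, hw⟩ | hw
      · exact .inl (occurs_of_infix_iterate_mu hw)
      · exact .inr ⟨c, hw⟩
      · exact .inl (hw.occurs h)
    · have hprefix : w.take 9 <:+: w := (List.take_prefix 9 w).isInfix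
      have hmem := (h.of_infix hprefix).mem_wordsAvoiding
      rw [List.length_take_of_le hlen] at hmem
      exact .inl (((isRigid_of_mem_wordsAvoiding _ hmem).of_infix hprefix).occurs h)
  · rintro (h | ⟨c, rfl⟩)
    · exact h.isPattern
    · exact isPattern_ccdcc c

theorem exists_letters_eq_ccdcc_iff {w : Word} :
    (∃ c : Letter, letters w = [c, c, c.swap, c, c]) ↔
      w = wa * wa * wb * wa * wa ∨ w = wb * wb * wa * wb * wb := by
  rw [← letters_injective.eq_iff, ← letters_injective.eq_iff]
  refine ⟨?_, ?_⟩
  · rintro ⟨_ | _, h⟩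
    · exact .inl h
    · exact .inr h
  · rintro (h | h)
    · exact ⟨a, h⟩
    · exact ⟨b, h⟩

end Classification

end ThueMorse

open ThueMorse in
theorem mainTheorem1 :
    (∀ w : Word, IsUnavoidableIn w thueMorse ↔
      (IsSegment thueMorse w ∨ w = wa * wa * wb * wa * wa ∨ w = wb * wb * wa * wb * wb)) ∧
    ¬ IsSegment thueMorse (wa * wa * wb * wa * wa) ∧
    ¬ IsSegment thueMorse (wb * wb * wa * wb * wb) := by
  simp only [isSegment_iff_occurs, isUnavoidableIn_iff_isPattern]
  exact ⟨fun w => isPattern_thueMorse_iff.trans (or_congr_right exists_letters_eq_ccdcc_iff),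
    not_occurs_ccdcc .a .b, not_occurs_ccdcc .b .a⟩
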